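/- A semigroup is a non-empty set with an associative operation. For a semigroup $S$ and a set $X$, let $S^X$ be the semigroup of all functions $X\to S$ under componentwise multiplication. A subdirect power of $S$ is a subsemigroup $T\le S^X$, for some set $X$, such that $\{f(x) : f\in T\}=S$ for every $x\in X$; it is called countable if the set $T$ is finite or countably infinite ($X$ itself may be arbitrary). A null semigroup is a semigroup $S$ having an element $0\in S$ such that $st=0$ for all $s,t\in S$. \textbf{Theorem.} Let $S$ be a finite commutative semigroup. Then the countable subdirect powers of $S$ fall into only countably many (finitely many or $\aleph_0$) isomorphism classes if and only if $S$ is an abelian group or a null semigroup. If $S$ is neither an abelian group nor a null semigroup, then the number of isomorphism classes of countable subdirect powers of $S$ is exactly the continuum $2^{\aleph_0}$. -/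

import Mathlib

universe u v

/-- A subsemigroup `T` of the direct power `S ^ X` (with componentwise multiplication) is a
*subdirect power* of `S` if it projects onto every factor. Semigroups are non-empty, so `T` is
required to be non-empty (this is automatic when `X` and `S` are non-empty). -/
def IsSubdirectPower {S : Type u} [Semigroup S] {X : Type v} (T : Subsemigroup (X → S)) : Prop :=
  (T : Set (X → S)).Nonempty ∧ ∀ x : X, {s : S | ∃ f ∈ T, f x = s} = Set.univ

/-- A countable subdirect power of `S`: an arbitrary index set `X` (not assumed countable) and
a subdirect power `T ≤ S ^ X` which is finite or countably infinite. -/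
structure CountableSubdirectPower (S : Type u) [Semigroup S] where
  /-- The index set. -/
  index : Type v
  /-- The underlying subsemigroup of the direct power. -/
  toSubsemigroup : Subsemigroup (index → S)
  isSubdirectPower : IsSubdirectPower toSubsemigroup
  countable : Countable toSubsemigroup

/-- Isomorphism of countable subdirect powers, as semigroups. -/
def CountableSubdirectPower.isoSetoid (S : Type u) [Semigroup S] :
    Setoid (CountableSubdirectPower.{u, v} S) where
  r P Q := Nonempty (P.toSubsemigroup ≃* Q.toSubsemigroup)
  iseqv :=
    { refl := fun _ => ⟨MulEquiv.refl _⟩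
      symm := fun ⟨e⟩ => ⟨e.symm⟩
      trans := fun ⟨e⟩ ⟨f⟩ => ⟨e.trans f⟩ }

/-- The subdirect power type of `S`: the number of isomorphism classes of countable subdirect
powers of `S`. -/
noncomputable def subdirectPowerType (S : Type u) [Semigroup S] : Cardinal.{max u (v + 1)} :=
  Cardinal.mk (Quotient (CountableSubdirectPower.isoSetoid.{u, v} S))

/-- The semigroup `S` is an abelian group under its own multiplication. -/
def IsAbelianGroupSemigroup (S : Type u) [Semigroup S] : Prop :=
  (∀ s t : S, s * t = t * s) ∧ ∃ e : S, (∀ s : S, e * s = s) ∧ ∀ s : S, ∃ t : S, t * s = e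

/-- The semigroup `S` is a null semigroup: there is an element `0` with `s t = 0` for all
`s`, `t`. -/
def IsNullSemigroup (S : Type u) [Semigroup S] : Prop :=
  ∃ z : S, ∀ s t : S, s * t = z

-- A countable semigroup is determined by a multiplication table on a subset of `ℕ`, so there are
-- never more than continuum many classes. A null subdirect power is determined by its cardinality.
-- If `S` is an abelian group, a subdirect power is an abelian group of exponent dividing `|S|`;
-- countable groups of bounded exponent are direct sums of cyclic groups (Prüfer–Baer), so countably
-- many models suffice (`exists_countable_models_of_bounded`).
--
-- Otherwise each `A ⊆ ℕ` is encoded in a countable subdirect power, and `A` is read back by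
-- counting. If `S` has two idempotents (`IsIdempotentAtom`), what is counted is the idempotents
-- above a given idempotent. If the idempotent `e` is unique, there are distinct elements acting
-- alike on `S`, and what is counted is the elements acting like a given one (`IsMarkedTriple`).
-- Here the ideal is `eS` when `e` is not a zero, and the annihilator of `S` when it is. In each
-- count, numbers shifted by `|S| + 1` keep the code apart from the effect of constants.

universe w

/-! ### Bounds on the number of isomorphism classes -/

section Counting

variable {S : Type u} [Semigroup S]

theorem subdirectPowerType_le_continuum :
    subdirectPowerType.{u, v} S ≤ Cardinal.continuum := by
  let Q := Quotient (CountableSubdirectPower.isoSetoid.{u, v} S)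
  have hφ : ∀ P : CountableSubdirectPower.{u, v} S,
      ∃ φ : P.toSubsemigroup → ℕ, Function.Injective φ := fun P => by
    have := P.countable
    exact exists_injective_nat _
  choose φ hφ using hφ
  let code : CountableSubdirectPower.{u, v} S → Set (ℕ × ℕ × ℕ) := fun P =>
    {x | ∃ a b, x = (φ P a, φ P b, φ P (a * b))}
  have key : ∀ P P', code P = code P' → Nonempty (P.toSubsemigroup ≃* P'.toSubsemigroup) := by
    intro P P' h
    have range_subset : ∀ P P', code P = code P' → ∀ a, ∃ a', φ P a = φ P' a' := by
      intro P P' h a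
      -- Every element occurs as a first coordinate, so the table also determines the set of labels.
      have : (φ P a, φ P a, φ P (a * a)) ∈ code P' := h ▸ ⟨a, a, rfl⟩
      obtain ⟨a', _, h'⟩ := this
      exact ⟨a', (Prod.ext_iff.1 h').1⟩
    choose g hg using range_subset P P' h
    refine ⟨MulEquiv.ofBijective (⟨g, fun a b => ?_⟩ : P.toSubsemigroup →ₙ* P'.toSubsemigroup)
      ⟨fun a b hab => hφ P ?_, fun a' => ?_⟩⟩
    · have : (φ P a, φ P b, φ P (a * b)) ∈ code P' := h ▸ ⟨a, b, rfl⟩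
      obtain ⟨a', b', h'⟩ := this
      simp only [Prod.mk.injEq, hg] at h'
      rw [hφ P' h'.1, hφ P' h'.2.1]
      exact hφ P' h'.2.2
    · have hab : g a = g b := hab
      rw [hg, hg, hab]
    · obtain ⟨a, ha⟩ := range_subset P' P h.symm a'
      exact ⟨a, hφ P' ((hg a).symm.trans ha.symm)⟩
  have hinj : Function.Injective (fun q : Q => code q.out) := by
    intro q q' h
    rw [← Quotient.out_eq q, ← Quotient.out_eq q']
    exact Quotient.sound (key _ _ h)
  have := Cardinal.lift_mk_le_lift_mk_of_injective hinj
  rw [Cardinal.mk_set, Cardinal.mk_eq_aleph0 (ℕ × ℕ × ℕ), Cardinal.two_power_aleph0,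
    Cardinal.lift_continuum, Cardinal.lift_le_continuum] at this
  exact this

/-- An inclusion is enough to ask for: the inverse isomorphism gives the other one. -/
theorem continuum_le_subdirectPowerType (F : Set ℕ → CountableSubdirectPower.{u, v} S)
    (hF : ∀ A B, Nonempty ((F A).toSubsemigroup ≃* (F B).toSubsemigroup) → A ⊆ B) :
    Cardinal.continuum ≤ subdirectPowerType.{u, v} S := by
  have hinj : Function.Injective (fun A : Set ℕ =>
      Quotient.mk (CountableSubdirectPower.isoSetoid.{u, v} S) (F A)) := by
    intro A B h
    obtain ⟨e⟩ : Nonempty ((F A).toSubsemigroup ≃* (F B).toSubsemigroup) := Quotient.exact h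
    exact (hF A B ⟨e⟩).antisymm (hF B A ⟨e.symm⟩)
  have := Cardinal.lift_mk_le_lift_mk_of_injective hinj
  rw [Cardinal.mk_set_nat, Cardinal.lift_continuum, Cardinal.continuum_le_lift] at this
  exact this

theorem subdirectPowerType_le_aleph0 {ι : Type*} [Countable ι]
    (R : CountableSubdirectPower.{u, v} S → ι → Prop) (hR : ∀ P, ∃ i, R P i)
    (hiso : ∀ P P' i, R P i → R P' i → Nonempty (P.toSubsemigroup ≃* P'.toSubsemigroup)) :
    subdirectPowerType.{u, v} S ≤ Cardinal.aleph0 := by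
  choose c hc using hR
  rw [subdirectPowerType, Cardinal.mk_le_aleph0_iff]
  refine Function.Injective.countable
    (f := fun q : Quotient (CountableSubdirectPower.isoSetoid.{u, v} S) => c q.out) ?_
  intro q q' h
  rw [← Quotient.out_eq q, ← Quotient.out_eq q']
  have h : c q.out = c q'.out := h
  exact Quotient.sound (hiso _ _ _ (hc _) (h ▸ hc _))

end Counting

/-! ### Null semigroups -/

/-- The types `Fin n` and `ℕ`, representing all countable types up to bijection. -/
def CountableModel (c : Option ℕ) : Type := c.elim ℕ Fin

theorem exists_equiv_countableModel (ι : Type*) [Countable ι] :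
    ∃ c, Nonempty (ι ≃ CountableModel c) := by
  cases finite_or_infinite ι
  · obtain ⟨n, ⟨e⟩⟩ := Finite.exists_equiv_fin ι
    exact ⟨some n, ⟨e⟩⟩
  · obtain ⟨e⟩ := nonempty_denumerable ι
    exact ⟨none, ⟨e.eqv⟩⟩

theorem IsNullSemigroup.nonempty_mulEquiv {M N : Type*} [Semigroup M] [Semigroup N]
    (hM : IsNullSemigroup M) (hN : IsNullSemigroup N) (h : Nonempty (M ≃ N)) :
    Nonempty (M ≃* N) := by
  classical
  obtain ⟨z, hz⟩ := hM
  obtain ⟨w, hw⟩ := hN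
  obtain ⟨e⟩ := h
  refine ⟨⟨e.trans (Equiv.swap (e z) w), fun a b => ?_⟩⟩
  simp [hz, hw]

theorem IsNullSemigroup.subdirectPowerType_le {S : Type u} [Semigroup S]
    (hS : IsNullSemigroup S) : subdirectPowerType.{u, v} S ≤ Cardinal.aleph0 := by
  have hnull : ∀ P : CountableSubdirectPower.{u, v} S, IsNullSemigroup P.toSubsemigroup := by
    intro P
    obtain ⟨z, hz⟩ := hS
    obtain ⟨t, ht⟩ := P.isSubdirectPower.1
    exact ⟨⟨t, ht⟩ * ⟨t, ht⟩, fun a b => Subtype.ext (funext fun x => by simp [hz])⟩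
  refine subdirectPowerType_le_aleph0
    (fun P c => Nonempty (P.toSubsemigroup ≃ CountableModel c)) (fun P => ?_) ?_
  · have := P.countable
    exact exists_equiv_countableModel _
  · rintro P P' c ⟨e⟩ ⟨e'⟩
    exact (hnull P).nonempty_mulEquiv (hnull P') ⟨e.trans e'.symm⟩

/-! ### Countable abelian groups of bounded exponent -/

section BoundedGroups

theorem ZMod.exists_eq_nsmul_of_nsmul_eq_zero {n a b : ℕ} (hn : n = a * b) (ha : 0 < a)
    (hb : 0 < b) (x : ZMod n) (hx : a • x = 0) : ∃ y, x = b • y := by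
  subst hn
  have : NeZero (a * b) := ⟨(Nat.mul_pos ha hb).ne'⟩
  rw [← ZMod.natCast_zmod_val x, nsmul_eq_mul, ← Nat.cast_mul, ZMod.natCast_eq_zero_iff] at hx
  obtain ⟨c, hc⟩ := Nat.dvd_of_mul_dvd_mul_left ha hx
  exact ⟨c, by rw [nsmul_eq_mul, ← Nat.cast_mul, ← hc, ZMod.natCast_zmod_val]⟩

theorem Finsupp.exists_eq_nsmul_of_nsmul_eq_zero {ι : Type*} {n a b : ℕ} (hn : n = a * b)
    (ha : 0 < a) (hb : 0 < b) (x : ι →₀ ZMod n) (hx : a • x = 0) : ∃ y, x = b • y := by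
  classical
  -- The quotient is chosen to be `0` at `0`, so that applying it coordinatewise keeps the support
  -- finite.
  have h : ∀ z : ZMod n, ∃ y, (a • z = 0 → z = b • y) ∧ (z = 0 → y = 0) := by
    intro z
    by_cases hz : z = 0
    · exact ⟨0, fun _ => by simp [hz], fun _ => rfl⟩
    · by_cases haz : a • z = 0
      · obtain ⟨y, hy⟩ := ZMod.exists_eq_nsmul_of_nsmul_eq_zero hn ha hb z haz
        exact ⟨y, fun _ => hy, fun h => absurd h hz⟩
      · exact ⟨0, fun h => absurd h haz, fun _ => rfl⟩
  choose d hd hd0 using h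
  refine ⟨x.mapRange d (hd0 0 rfl), Finsupp.ext fun i => ?_⟩
  simpa using hd (x i) (by simpa using DFunLike.congr_fun hx i)

variable {G : Type w} [AddCommGroup G]

/-- The divisibility condition makes `F` behave like a free module over `ZMod (p * q)`, which is
injective over itself. A maximal `H` disjoint from `F` is a complement: `F ⊔ H` is closed under
division by every prime, and it contains `(p * q * r) • g = 0`. -/
theorem exists_isCompl_of_divisibility {p q r : ℕ} (hp : p.Prime) (hq : ∃ j, q = p ^ j)
    (hr : r.Coprime p) (hm : ∀ g : G, (p * q * r) • g = 0) (F : Submodule ℤ G)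
    (hF : ∀ f ∈ F, (p * q) • f = 0) (hdiv : ∀ f ∈ F, q • f = 0 → ∃ f' ∈ F, f = p • f') :
    ∃ H : Submodule ℤ G, IsCompl F H := by
  obtain ⟨j, rfl⟩ := hq
  have hm0 : 0 < p * p ^ j * r := by
    have : r ≠ 0 := by
      rintro rfl
      exact hp.one_lt.ne' (by simpa using hr)
    have := hp.pos
    positivity
  obtain ⟨H, -, hH⟩ := zorn_le_nonempty₀ {H : Submodule ℤ G | Disjoint F H} (by
    intro c hc hchain y hy
    refine ⟨sSup c, ?_, fun z hz => le_sSup hz⟩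
    rw [Set.mem_ofPred_eq, Submodule.disjoint_def]
    intro x hxF hx
    obtain ⟨H, hH, hxH⟩ := (Submodule.mem_sSup_of_directed ⟨y, hy⟩ hchain.directedOn).1 hx
    exact (Submodule.disjoint_def.1 (hc hH)) x hxF hxH) ⊥ disjoint_bot_right
  refine ⟨H, hH.prop, codisjoint_iff.2 (eq_top_iff.2 fun g _ => ?_)⟩
  have hdisj := Submodule.disjoint_def.1 hH.prop
  have main : ∀ (l : ℕ), l.Prime → ∀ g : G, l • g ∈ H → g ∈ F ⊔ H := by
    intro l hl g hg
    by_cases hgH : g ∈ H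
    · exact Submodule.mem_sup_right hgH
    -- Maximality of `H` gives a nonzero `h + a • g` in `F`. Here `l ∤ a`, since otherwise it would
    -- lie in `F ⊓ H`, and Bézout recovers `g`.
    have hlt : ¬ Disjoint F (H ⊔ Submodule.span ℤ {g}) := fun hd =>
      hgH (hH.le_of_ge hd le_sup_left (Submodule.mem_sup_right (Submodule.mem_span_singleton_self g)))
    rw [Submodule.disjoint_def] at hlt
    push Not at hlt
    obtain ⟨f, hf, hf', hf0⟩ := hlt
    obtain ⟨h, hh, y, hy, rfl⟩ := Submodule.mem_sup.1 hf'
    obtain ⟨a, rfl⟩ := Submodule.mem_span_singleton.1 hy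
    have hlg : (l : ℤ) • g ∈ H := by simpa using hg
    by_cases hla : (l : ℤ) ∣ a
    · obtain ⟨c, rfl⟩ := hla
      refine absurd (hdisj _ hf (H.add_mem hh ?_)) hf0
      rw [mul_comm, mul_smul]
      exact H.smul_mem c hlg
    · have hcop : IsCoprime (l : ℤ) a :=
        (Prime.coprime_iff_not_dvd (Nat.prime_iff_prime_int.1 hl)).2 hla
      obtain ⟨s, t, hst⟩ := hcop
      have : g = t • (h + a • g) + (s • (l : ℤ) • g - t • h) := by
        conv_lhs => rw [← one_smul ℤ g, ← hst]
        module
      rw [this]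
      exact Submodule.add_mem_sup (F.smul_mem t hf)
        (H.sub_mem (H.smul_mem s hlg) (H.smul_mem t hh))
  have step : ∀ (l : ℕ), l.Prime → ∀ g : G, l • g ∈ F ⊔ H → g ∈ F ⊔ H := by
    intro l hl g hg
    obtain ⟨f, hf, h, hh, hfh⟩ := Submodule.mem_sup.1 hg
    -- For `l = p`, `(q * r) • f` lies in `F ⊓ H`, so it vanishes; together with `(p * q) • f = 0`
    -- this gives `q • f = 0`. For `l ≠ p`, `l` is invertible modulo `p * q`.
    have : ∃ f' ∈ F, f = l • f' := by
      by_cases hlp : l = p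
      · subst hlp
        refine hdiv f hf ?_
        have h1 : (l ^ j * r) • f = 0 := by
          have h2 : (l ^ j * r) • f + (l ^ j * r) • h = 0 := by
            rw [← smul_add, hfh, ← mul_smul, ← hm g]
            congr 1
            ring
          refine hdisj _ (F.smul_of_tower_mem _ hf) ?_
          rw [eq_neg_of_add_eq_zero_left h2]
          exact H.neg_mem (H.smul_of_tower_mem _ hh)
        obtain ⟨s, t, hst⟩ := Nat.isCoprime_iff_coprime.2 hr
        have h2 := hF f hf
        have h3 : ((l : ℤ) ^ j * r) • f = 0 := by exact_mod_cast h1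
        have h4 : ((l : ℤ) * l ^ j) • f = 0 := by exact_mod_cast h2
        have h5 : ((l : ℤ) ^ j) • f = s • ((l : ℤ) ^ j * r) • f + t • ((l : ℤ) * l ^ j) • f := by
          rw [← mul_smul, ← mul_smul, ← add_smul]
          congr 1
          linear_combination (-(l : ℤ) ^ j) * hst
        rw [h3, h4, smul_zero, smul_zero, add_zero] at h5
        exact_mod_cast h5
      · have hcop : IsCoprime (l : ℤ) ((p * p ^ j : ℕ) : ℤ) := by
          rw [Nat.isCoprime_iff_coprime, ← pow_succ']
          exact ((Nat.coprime_primes hl hp).2 hlp).pow_right _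
        obtain ⟨s, t, hst⟩ := hcop
        refine ⟨s • f, F.smul_mem s hf, ?_⟩
        have h4 : ((p * p ^ j : ℕ) : ℤ) • f = 0 := by rw [natCast_zsmul]; exact hF f hf
        conv_lhs => rw [← one_smul ℤ f, ← hst, add_smul, mul_smul t, h4, smul_zero, add_zero]
        rw [← natCast_zsmul, ← mul_smul, mul_comm]
    obtain ⟨f', hf', rfl⟩ := this
    have : g - f' ∈ F ⊔ H := main l hl _ (by rw [smul_sub, ← hfh]; simpa using hh)
    simpa using (F ⊔ H).add_mem this (Submodule.mem_sup_left hf')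
  have all : ∀ n : ℕ, 0 < n → ∀ g : G, n • g ∈ F ⊔ H → g ∈ F ⊔ H := by
    intro n
    induction n using Nat.recOnMul with
    | zero => intro h; exact absurd h (lt_irrefl 0)
    | one => intro _ g hg; simpa using hg
    | prime l hl => intro _ g hg; exact step l hl g hg
    | mul a b ha hb =>
      intro h g hg
      rw [mul_smul] at hg
      exact hb (Nat.pos_of_mul_pos_left h) g (ha (Nat.pos_of_mul_pos_right h) _ hg)
  exact all _ hm0 g (by rw [hm]; exact Submodule.zero_mem _)

theorem exists_addEquiv_finsupp_zmod_prime {p : ℕ} (hp : p.Prime) (hG : ∀ g : G, p • g = 0) :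
    ∃ (ι : Type w) (_ : G ≃+ (ι →₀ ZMod p)), True := by
  have : Fact p.Prime := ⟨hp⟩
  let : Module (ZMod p) G := AddCommGroup.zmodModule hG
  exact ⟨_, (Module.Basis.ofVectorSpace (ZMod p) G).repr.toAddEquiv, trivial⟩

/-- The subgroup `V = (q * r) G` is a vector space over `ZMod p`. Lifting a basis of it through `q *
r` and multiplying by `r` gives independent elements of order `p * q`. Their span contains `V`, so
`q * r` kills any complement. -/
theorem exists_addEquiv_finsupp_prod [Countable G] {p q r : ℕ} (hp : p.Prime)
    (hq : ∃ j, q = p ^ j) (hr : r.Coprime p) (hm : ∀ g : G, (p * q * r) • g = 0) :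
    ∃ (ι : Type w) (H : AddSubgroup G), Countable ι ∧ (∀ h : H, (q * r) • h = 0) ∧
      Nonempty (G ≃+ (ι →₀ ZMod (p * q)) × H) := by
  have hp0 := hp.pos
  have hq0 : 0 < q := by obtain ⟨j, rfl⟩ := hq; positivity
  have : Fact p.Prime := ⟨hp⟩
  let V : AddSubgroup G := (nsmulAddMonoidHom (q * r) : G →+ G).range
  obtain ⟨ι, ρ, -⟩ := exists_addEquiv_finsupp_zmod_prime (G := V) hp (by
    rintro ⟨_, g, rfl⟩
    refine Subtype.ext ?_
    simpa [← mul_smul, mul_assoc] using hm g)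
  have hι : Countable ι := (ρ.symm.injective.comp
    (Finsupp.single_left_injective (one_ne_zero (α := ZMod p)))).countable
  have hx : ∀ i, ∃ x : G, (q * r) • x = ρ.symm (Finsupp.single i 1) :=
    fun i => (ρ.symm (Finsupp.single i 1)).2
  choose x hx using hx
  let Φ : (ι →₀ ZMod (p * q)) →+ G := Finsupp.liftAddHom fun i =>
    ZMod.lift (p * q) ⟨zmultiplesHom G (r • x i), by
      rw [zmultiplesHom_apply, natCast_zsmul, ← mul_smul]; exact hm _⟩
  have hΦ : ∀ v : ι →₀ ZMod (p * q), Φ (q • v) =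
      (ρ.symm (v.mapRange (ZMod.castHom (dvd_mul_right p q) (ZMod p)) (map_zero _)) : G) := by
    intro v
    induction v using Finsupp.induction_linear with
    | zero => simp
    | add v v' h h' =>
      rw [smul_add, map_add, h, h', Finsupp.mapRange_add (map_add _), map_add, AddSubgroup.coe_add]
    | single i a =>
      have : NeZero (p * q) := ⟨(Nat.mul_pos hp0 hq0).ne'⟩
      rw [← ZMod.natCast_zmod_val a, Finsupp.mapRange_single, map_natCast,
        ← nsmul_one (A := ZMod p), ← Finsupp.smul_single, map_nsmul Φ, map_nsmul ρ.symm,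
        AddSubgroup.coe_nsmul, ← hx, Finsupp.liftAddHom_apply_single, ← Int.cast_natCast a.val, ZMod.lift_coe]
      simp only [zmultiplesHom_apply, natCast_zsmul, ← mul_smul]
      congr 1
      ring
  have hker : ∀ v, Φ (q • v) = 0 → q • v = 0 := by
    intro v hv
    rw [hΦ, ZeroMemClass.coe_eq_zero, map_eq_zero_iff _ ρ.symm.injective] at hv
    ext i
    have hi := DFunLike.congr_fun hv i
    have : NeZero (p * q) := ⟨(Nat.mul_pos hp0 hq0).ne'⟩
    rw [Finsupp.mapRange_apply, ← ZMod.natCast_zmod_val (v i), map_natCast, Finsupp.coe_zero,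
      Pi.zero_apply, ZMod.natCast_eq_zero_iff] at hi
    rw [Finsupp.smul_apply, ← ZMod.natCast_zmod_val (v i), nsmul_eq_mul, ← Nat.cast_mul,
      Finsupp.coe_zero, Pi.zero_apply, ZMod.natCast_eq_zero_iff, mul_comm q]
    exact Nat.mul_dvd_mul_right hi q
  have hinj : Function.Injective Φ := by
    rw [injective_iff_map_eq_zero]
    intro u hu
    -- If `p ^ (j + 1)` kills `u`, then `p ^ j • u` is `p`-torsion, hence a multiple of `q`, where
    -- `hker` applies.
    have key : ∀ j : ℕ, ∀ u, Φ u = 0 → p ^ j • u = 0 → u = 0 := by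
      intro j
      induction j with
      | zero => intro u _ h; simpa using h
      | succ j ih =>
        intro u hu h
        obtain ⟨v, hv⟩ := Finsupp.exists_eq_nsmul_of_nsmul_eq_zero rfl hp0 hq0 (p ^ j • u)
          (by rw [← mul_smul, ← pow_succ']; exact h)
        refine ih u hu ?_
        rw [hv]
        exact hker v (by rw [← hv, map_nsmul, hu, smul_zero])
    obtain ⟨j, rfl⟩ := hq
    refine key (j + 1) u hu ?_
    ext i
    simp only [Finsupp.smul_apply, nsmul_eq_mul, pow_succ', ZMod.natCast_self, zero_mul,
      Finsupp.coe_zero, Pi.zero_apply]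
  let F : Submodule ℤ G := AddSubgroup.toIntSubmodule Φ.range
  obtain ⟨H, hH⟩ := exists_isCompl_of_divisibility hp hq hr hm F
    (by
      rintro _ ⟨u, rfl⟩
      rw [← map_nsmul]
      convert map_zero Φ
      ext i
      simp only [Finsupp.smul_apply, nsmul_eq_mul, ZMod.natCast_self, zero_mul,
        Finsupp.coe_zero, Pi.zero_apply])
    (by
      rintro _ ⟨u, rfl⟩ h
      rw [← map_nsmul] at h
      have h := hinj (h.trans (map_zero Φ).symm)
      obtain ⟨y, rfl⟩ := Finsupp.exists_eq_nsmul_of_nsmul_eq_zero (mul_comm p q) hq0 hp0 u h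
      exact ⟨Φ y, ⟨y, rfl⟩, map_nsmul _ _ _⟩)
  refine ⟨ι, H.toAddSubgroup, hι, fun h => ?_, ?_⟩
  · refine Subtype.ext (Submodule.disjoint_def.1 hH.disjoint _ ?_ (H.smul_of_tower_mem _ h.2))
    have : (q * r) • (h : G) ∈ V := ⟨h, rfl⟩
    obtain ⟨u, hu⟩ := Finsupp.mapRange_surjective (ZMod.castHom (dvd_mul_right p q) (ZMod p))
      (map_zero _) (ZMod.castHom_surjective _) (ρ ⟨_, this⟩)
    refine ⟨q • u, ?_⟩
    rw [hΦ, hu, AddEquiv.symm_apply_apply]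
    rfl
  · exact ⟨(Submodule.prodEquivOfIsCompl F H hH).symm.toAddEquiv.trans
      (AddEquiv.prodCongr (AddMonoidHom.ofInjective hinj).symm (AddEquiv.refl _))⟩

/-- Induction on the exponent: splitting off copies of the largest cyclic `p`-group lowers `m` to `m
/ p`. -/
theorem exists_countable_models_of_bounded (m : ℕ) (hm : 0 < m) :
    ∃ (κ : Type) (_ : Countable κ) (A : κ → AddCommGrpCat.{0}),
      ∀ (G : Type w) [AddCommGroup G] [Countable G], (∀ g : G, m • g = 0) →
        ∃ i, Nonempty (G ≃+ A i) := by
  induction m using Nat.strong_induction_on with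
  | _ m ih =>
    by_cases hm1 : m = 1
    · refine ⟨Unit, inferInstance, fun _ => AddCommGrpCat.of Unit, fun G _ _ hG => ⟨(), ?_⟩⟩
      have : Subsingleton G := subsingleton_of_forall_eq 0 fun g => by simpa [hm1] using hG g
      have : Unique G := uniqueOfSubsingleton 0
      exact ⟨(AddEquiv.ofUnique : G ≃+ Unit)⟩
    · have hp := Nat.minFac_prime hm1
      obtain ⟨n, r, hr, hnr⟩ := Nat.exists_eq_pow_mul_and_not_dvd hm.ne' m.minFac hp.ne_one
      obtain ⟨j, rfl⟩ : ∃ j, n = j + 1 := Nat.exists_eq_succ_of_ne_zero (by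
        rintro rfl
        rw [pow_zero, one_mul] at hnr
        exact hr (by rw [← hnr]; exact m.minFac_dvd))
      generalize m.minFac = p at hp hr hnr
      rw [pow_succ'] at hnr
      have hr0 : 0 < r := Nat.pos_of_ne_zero fun h => hr (h ▸ dvd_zero p)
      have hlt : p ^ j * r < m := by
        rw [hnr, mul_assoc]
        exact lt_mul_of_one_lt_left (Nat.mul_pos (pow_pos hp.pos j) hr0) hp.one_lt
      obtain ⟨κ, hκ, A, hA⟩ := ih _ hlt (Nat.mul_pos (pow_pos hp.pos j) hr0)
      refine ⟨Option ℕ × κ, inferInstance, fun c => AddCommGrpCat.of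
        ((CountableModel c.1 →₀ ZMod (p * p ^ j)) × A c.2), fun G _ _ hG => ?_⟩
      obtain ⟨ι, H, hι, hH, ⟨e⟩⟩ := exists_addEquiv_finsupp_prod (G := G) hp ⟨j, rfl⟩
        ((Nat.Prime.coprime_iff_not_dvd hp).2 hr).symm (by simpa [← hnr] using hG)
      obtain ⟨c, ⟨e'⟩⟩ := exists_equiv_countableModel ι
      obtain ⟨i, ⟨e''⟩⟩ := hA H hH
      exact ⟨(c, i), ⟨e.trans (AddEquiv.prodCongr (Finsupp.domCongr e') e'')⟩⟩

end BoundedGroups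

/-! ### Subdirect powers of finite abelian groups -/

section Groups

/-- A semigroup that is an abelian group, with its group structure. -/
noncomputable abbrev IsAbelianGroupSemigroup.commGroup {S : Type u} [Semigroup S]
    (h : IsAbelianGroupSemigroup S) : CommGroup S :=
  { (inferInstance : Semigroup S) with
    one := h.2.choose
    one_mul := h.2.choose_spec.1
    mul_one := fun s => (h.1 _ _).trans (h.2.choose_spec.1 s)
    inv := fun s => (h.2.choose_spec.2 s).choose
    inv_mul_cancel := fun s => (h.2.choose_spec.2 s).choose_spec
    mul_comm := h.1 }

theorem CountableSubdirectPower.exists_mulEquiv_subgroup {S : Type u} [CommGroup S] [Finite S]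
    (P : CountableSubdirectPower.{u, v} S) :
    ∃ K : Subgroup (P.index → S), Nonempty (P.toSubsemigroup ≃* K) ∧
      ∀ t : K, t ^ Nat.card S = 1 := by
  have hpow : ∀ t : P.index → S, t ^ Nat.card S = 1 := fun t => funext fun x => pow_card_eq_one'
  have hcard : 0 < Nat.card S := Nat.card_pos
  have hmem : ∀ t ∈ P.toSubsemigroup, ∀ k, t ^ (k + 1) ∈ P.toSubsemigroup := by
    intro t ht k
    induction k with
    | zero => simpa using ht
    | succ k ih =>
      rw [pow_succ]
      exact P.toSubsemigroup.mul_mem ih ht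
  have hone : (1 : P.index → S) ∈ P.toSubsemigroup := by
    obtain ⟨t, ht⟩ := P.isSubdirectPower.1
    have := hmem t ht (Nat.card S - 1)
    rwa [Nat.sub_add_cancel hcard, hpow] at this
  let K : Subgroup (P.index → S) :=
    { P.toSubsemigroup with
      one_mem' := hone
      inv_mem' := fun {t} ht => by
        -- The inverse is the power `2 |S| - 1`, which is positive even when `|S| = 1`.
        have := hmem t ht (Nat.card S - 1 + (Nat.card S - 1))
        have h : t ^ (Nat.card S - 1 + (Nat.card S - 1) + 1) = t⁻¹ := by
          refine eq_inv_of_mul_eq_one_left ?_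
          rw [← pow_succ, show Nat.card S - 1 + (Nat.card S - 1) + 1 + 1 =
            Nat.card S + Nat.card S by omega, pow_add, hpow, one_mul]
        rwa [h] at this }
  exact ⟨K, ⟨⟨Equiv.refl _, fun _ _ => rfl⟩⟩, fun t => Subtype.ext (hpow _)⟩

theorem IsAbelianGroupSemigroup.subdirectPowerType_le {S : Type u} [inst : Semigroup S] [Finite S]
    (hS : IsAbelianGroupSemigroup S) : subdirectPowerType.{u, v} S ≤ Cardinal.aleph0 := by
  obtain ⟨C, hC⟩ : ∃ C : CommGroup S, C.toSemigroup = inst := ⟨hS.commGroup, rfl⟩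
  subst hC
  obtain ⟨κ, hκ, A, hA⟩ :=
    exists_countable_models_of_bounded.{max u v} (Nat.card S) Nat.card_pos
  refine subdirectPowerType_le_aleph0
    (fun P c => Nonempty (P.toSubsemigroup ≃* Multiplicative (A c))) (fun P => ?_) ?_
  · obtain ⟨K, ⟨e⟩, hexp⟩ := P.exists_mulEquiv_subgroup
    have := P.countable
    have : Countable (Additive K) := e.symm.injective.countable
    obtain ⟨i, ⟨e'⟩⟩ := hA (Additive K) hexp
    exact ⟨i, ⟨e.trans (AddEquiv.toMultiplicativeRight e')⟩⟩
  · rintro P P' c ⟨e⟩ ⟨e'⟩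
    exact ⟨e.trans e'.symm⟩

end Groups

/-! ### Subdirect powers containing the constants -/

section Constructions

variable {S : Type u}

/-- A countable subsemigroup of `S ^ (ℕ × ℕ)` containing all constants, as a countable subdirect
power of `S`. -/
def CountableSubdirectPower.ofConst [Semigroup S] [Nonempty S] (T : Subsemigroup (ℕ × ℕ → S))
    (hT : (T : Set (ℕ × ℕ → S)).Countable) (hconst : ∀ s, (fun _ => s) ∈ T) :
    CountableSubdirectPower.{u, v} S where
  index := ULift.{v} (ℕ × ℕ)
  toSubsemigroup := T.comap
    (⟨fun f x => f (ULift.up x), fun _ _ => rfl⟩ : (ULift.{v} (ℕ × ℕ) → S) →ₙ* (ℕ × ℕ → S))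
  isSubdirectPower := by
    refine ⟨?_, fun x => Set.eq_univ_of_forall fun s => ⟨fun _ => s, hconst s, rfl⟩⟩
    obtain ⟨s⟩ := ‹Nonempty S›
    exact ⟨fun _ => s, hconst s⟩
  countable := by
    have := hT.to_subtype
    exact Function.Injective.countable
      (f := fun t => (⟨fun x => t.1 (ULift.up x), t.2⟩ : (T : Set (ℕ × ℕ → S))))
      fun a b h => Subtype.ext (funext fun x => congrFun (Subtype.ext_iff.1 h) x.down)

/-- The subsemigroup underlying `CountableSubdirectPower.ofConst T` is `T` itself. -/
def CountableSubdirectPower.ofConstEquiv [Semigroup S] [Nonempty S] (T : Subsemigroup (ℕ × ℕ → S))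
    (hT : (T : Set (ℕ × ℕ → S)).Countable) (hconst : ∀ s, (fun _ => s) ∈ T) :
    (CountableSubdirectPower.ofConst.{u, v} T hT hconst).toSubsemigroup ≃* T where
  toFun t := ⟨fun x => t.1 (ULift.up x), t.2⟩
  invFun t := ⟨fun x => t.1 x.down, t.2⟩
  left_inv _ := rfl
  right_inv _ := rfl
  map_mul' _ _ := rfl

theorem continuum_le_subdirectPowerType_of_family [Semigroup S] [Nonempty S]
    (T : Set ℕ → Subsemigroup (ℕ × ℕ → S)) (hT : ∀ A, (T A : Set (ℕ × ℕ → S)).Countable)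
    (hconst : ∀ A s, (fun _ => s) ∈ T A) (hiso : ∀ A B, (T A ≃* T B) → A ⊆ B) :
    Cardinal.continuum ≤ subdirectPowerType.{u, v} S := by
  refine continuum_le_subdirectPowerType
    (fun A => .ofConst (T A) (hT A) (hconst A)) fun A B ⟨e⟩ => hiso A B ?_
  exact ((CountableSubdirectPower.ofConstEquiv _ _ _).symm.trans e).trans
    (CountableSubdirectPower.ofConstEquiv _ _ _)

end Constructions

/-! ### Semigroups with two idempotents -/

section TwoIdempotents

variable {S : Type u}

/-- The function equal to `e` at `(n, 0)` and `(n, j)`, and to `f` elsewhere. -/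
def twoPoint (e f : S) (n j : ℕ) (x : ℕ × ℕ) : S :=
  open Classical in if x.1 = n ∧ (x.2 = 0 ∨ x.2 = j) then e else f

theorem twoPoint_injective {e f : S} (h : e ≠ f) (n : ℕ) :
    Function.Injective (twoPoint e f n) := by
  intro i j hij
  by_contra hne
  have h1 := congrFun hij (n, i)
  have h2 := congrFun hij (n, j)
  simp only [twoPoint, true_and, or_true, if_true, Ne.symm hne, hne, or_false] at h1 h2
  split_ifs at h1 h2 <;> first | omega | exact h h1 | exact h h2.symm

theorem twoPoint_ne_const {e f : S} (h : e ≠ f) (n j : ℕ) (s : S) :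
    twoPoint e f n j ≠ fun _ => s := by
  intro hs
  have h1 := congrFun hs (n, 0)
  have h2 := congrFun hs (n + 1, 0)
  simp [twoPoint] at h1 h2
  exact h (h1.trans h2.symm)

/-- The idempotents of `T` lying above `t`. -/
def idempotentsAbove {M : Type*} [Semigroup M] (T : Subsemigroup M) (t : M) : Set M :=
  {u | u ∈ T ∧ u * u = u ∧ u * t = t}

theorem ncard_idempotentsAbove {M N : Type*} [Semigroup M] [Semigroup N] {T : Subsemigroup M}
    {T' : Subsemigroup N} (φ : T ≃* T') (t : T) :
    (idempotentsAbove T' (φ t : N)).ncard = (idempotentsAbove T (t : M)).ncard := by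
  symm
  refine Set.ncard_congr (fun u hu => (φ ⟨u, hu.1⟩ : N)) ?_ ?_ ?_
  · rintro u ⟨hu, h1, h2⟩
    refine ⟨(φ _).2, ?_, ?_⟩
    · rw [← MulMemClass.coe_mul, ← map_mul]
      exact congrArg (fun z => (φ z : N)) (Subtype.ext h1)
    · rw [← MulMemClass.coe_mul, ← map_mul]
      exact congrArg (fun z => (φ z : N)) (Subtype.ext h2)
  · rintro u u' hu hu' h
    exact Subtype.ext_iff.1 (φ.injective (Subtype.ext h))
  · rintro u ⟨hu, h1, h2⟩
    refine ⟨φ.symm ⟨u, hu⟩, ⟨(φ.symm _).2, ?_, ?_⟩, by simp⟩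
    · rw [← MulMemClass.coe_mul, ← map_mul]
      exact congrArg (fun z => (φ.symm z : M)) (Subtype.ext h1)
    · have : φ.symm ⟨u, hu⟩ * t = t := by
        apply φ.injective
        rw [map_mul, MulEquiv.apply_symm_apply]
        exact Subtype.ext h2
      exact Subtype.ext_iff.1 this

variable [CommSemigroup S]

/-- `f` is the least idempotent of `S`, and `e` is minimal among the other idempotents. -/
structure IsIdempotentAtom (e f : S) : Prop where
  idem_left : e * e = e
  idem_right : f * f = f
  mul_eq : e * f = f
  ne : e ≠ f
  least : ∀ h : S, h * h = h → h * f = f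
  atom : ∀ h : S, h * h = h → e * h = h → h = e ∨ h = f

namespace IsIdempotentAtom

variable {e f : S} (H : IsIdempotentAtom e f)
include H

theorem twoPoint_mul_self (n j : ℕ) : twoPoint e f n j * twoPoint e f n j = twoPoint e f n j := by
  funext x
  simp only [twoPoint, Pi.mul_apply]
  split_ifs
  · exact H.idem_left
  · exact H.idem_right

/-- The product takes the value `e` on the intersection of the two supports, which is the single
point `(n, 0)`. -/
theorem twoPoint_mul_of_ne {n i j : ℕ} (h : i ≠ j) :
    twoPoint e f n i * twoPoint e f n j = twoPoint e f n 0 := by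
  funext x
  simp only [twoPoint, Pi.mul_apply]
  split_ifs <;> first | exact H.idem_left | exact H.idem_right | exact H.mul_eq |
    exact (mul_comm f e).trans H.mul_eq | (exfalso; omega)

theorem twoPoint_mul_of_ne' {n m i j : ℕ} (h : n ≠ m) :
    twoPoint e f n i * twoPoint e f m j = fun _ => f := by
  funext x
  simp only [twoPoint, Pi.mul_apply]
  split_ifs <;> first | exact H.idem_left | exact H.idem_right | exact H.mul_eq |
    exact (mul_comm f e).trans H.mul_eq | (exfalso; omega)

/-- The subsemigroup generated by the constants and the functions `twoPoint e f n j`, `j ≤ m n`. -/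
def family (m : ℕ → ℕ) : Subsemigroup (ℕ × ℕ → S) where
  carrier := {t | (∃ s, t = fun _ => s) ∨ ∃ s n j, j ≤ m n ∧ t = (fun _ => s) * twoPoint e f n j}
  mul_mem' := by
    have aux : ∀ n j n' j', j ≤ m n → j' ≤ m n' →
        (twoPoint e f n j * twoPoint e f n' j' = fun _ => f) ∨ ∃ i ≤ m n,
          twoPoint e f n j * twoPoint e f n' j' = twoPoint e f n i := by
      intro n j n' j' hj hj'
      by_cases hn : n = n'
      · subst hn
        by_cases h : j = j'
        · subst h
          exact Or.inr ⟨j, hj, H.twoPoint_mul_self n j⟩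
        · exact Or.inr ⟨0, Nat.zero_le _, H.twoPoint_mul_of_ne h⟩
      · exact Or.inl (H.twoPoint_mul_of_ne' hn)
    rintro _ _ (⟨s, rfl⟩ | ⟨s, n, j, hj, rfl⟩) (⟨s', rfl⟩ | ⟨s', n', j', hj', rfl⟩)
    · exact Or.inl ⟨s * s', rfl⟩
    · exact Or.inr ⟨s * s', n', j', hj', by rw [← mul_assoc]; rfl⟩
    · exact Or.inr ⟨s * s', n, j, hj, by rw [mul_right_comm]; rfl⟩
    · rw [mul_mul_mul_comm]
      obtain h | ⟨i, hi, h⟩ := aux n j n' j' hj hj'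
      · rw [h]
        exact Or.inl ⟨s * s' * f, rfl⟩
      · rw [h]
        exact Or.inr ⟨s * s', n, i, hi, rfl⟩

theorem const_mem (m : ℕ → ℕ) (s : S) : (fun _ => s) ∈ H.family m := Or.inl ⟨s, rfl⟩

theorem twoPoint_mem {m : ℕ → ℕ} {n j : ℕ} (hj : j ≤ m n) : twoPoint e f n j ∈ H.family m := by
  refine Or.inr ⟨e, n, j, hj, ?_⟩
  funext x
  simp only [twoPoint, Pi.mul_apply]
  split_ifs
  · exact H.idem_left.symm
  · exact H.mul_eq.symm

theorem countable_family [Finite S] (m : ℕ → ℕ) : (H.family m : Set (ℕ × ℕ → S)).Countable := by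
  refine ((Set.countable_range fun s : S => fun _ : ℕ × ℕ => s).union (Set.countable_range
    fun p : S × ℕ × ℕ => (fun _ => p.1) * twoPoint e f p.2.1 p.2.2)).mono ?_
  rintro t (⟨s, rfl⟩ | ⟨s, n, j, -, rfl⟩)
  · exact Or.inl ⟨s, rfl⟩
  · exact Or.inr ⟨(s, n, j), rfl⟩

/-- For a non-constant generator times `s`, the idempotent `s * e` lies below the atom `e`, and `s *
f` must be `f`. -/
theorem eq_of_idempotent {m : ℕ → ℕ} {t : ℕ × ℕ → S} (ht : t ∈ H.family m) (hi : t * t = t) :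
    (∃ h, h * h = h ∧ t = fun _ => h) ∨ ∃ n j, j ≤ m n ∧ t = twoPoint e f n j := by
  obtain ⟨s, rfl⟩ | ⟨s, n, j, hj, rfl⟩ := ht
  · exact Or.inl ⟨s, congrFun hi (0, 0), rfl⟩
  · have h1 := congrFun hi (n, 0)
    have h2 := congrFun hi (n + 1, 0)
    simp [twoPoint] at h1 h2
    have h3 : s * f = f := by
      have := H.least _ h2
      rwa [mul_assoc, H.idem_right] at this
    obtain h4 | h4 := H.atom _ h1 (by rw [mul_left_comm, H.idem_left])
    · refine Or.inr ⟨n, j, hj, ?_⟩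
      funext x
      simp only [twoPoint, Pi.mul_apply]
      split_ifs
      · exact h4
      · exact h3
    · refine Or.inl ⟨f, H.idem_right, ?_⟩
      funext x
      simp only [twoPoint, Pi.mul_apply]
      split_ifs
      · exact h4
      · exact h3

theorem const_mul_twoPoint_eq_iff {h : S} (n j : ℕ) (hh : h * h = h) :
    (fun _ => h) * twoPoint e f n j = twoPoint e f n j ↔ h * e = e := by
  constructor
  · intro hx
    simpa [twoPoint] using congrFun hx (n, 0)
  · intro hx
    funext x
    simp only [twoPoint, Pi.mul_apply]
    split_ifs
    · exact hx
    · exact H.least h hh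

theorem idempotentsAbove_twoPoint_zero (m : ℕ → ℕ) (n : ℕ) :
    idempotentsAbove (H.family m) (twoPoint e f n 0) =
      (fun h : S => fun _ : ℕ × ℕ => h) '' {h | h * h = h ∧ h * e = e} ∪
        twoPoint e f n '' Set.Iic (m n) := by
  ext u
  constructor
  · rintro ⟨hu, hi, h⟩
    obtain ⟨s, hs, rfl⟩ | ⟨n', j, hj, rfl⟩ := H.eq_of_idempotent hu hi
    · exact Or.inl ⟨s, ⟨hs, (H.const_mul_twoPoint_eq_iff n 0 hs).1 h⟩, rfl⟩
    · by_cases hn : n' = n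
      · subst hn
        exact Or.inr ⟨j, hj, rfl⟩
      · rw [H.twoPoint_mul_of_ne' hn] at h
        exact absurd h.symm (twoPoint_ne_const H.ne _ _ _)
  · rintro (⟨s, ⟨hs, hse⟩, rfl⟩ | ⟨j, hj, rfl⟩)
    · exact ⟨H.const_mem m s, funext fun _ => hs, (H.const_mul_twoPoint_eq_iff n 0 hs).2 hse⟩
    · refine ⟨H.twoPoint_mem hj, H.twoPoint_mul_self n j, ?_⟩
      by_cases h : j = 0
      · rw [h, H.twoPoint_mul_self]
      · exact H.twoPoint_mul_of_ne h

theorem idempotentsAbove_twoPoint_of_ne_zero {m : ℕ → ℕ} {n j : ℕ} (hj : j ≠ 0) :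
    idempotentsAbove (H.family m) (twoPoint e f n j) ⊆
      (fun h : S => fun _ : ℕ × ℕ => h) '' {h | h * h = h ∧ h * e = e} ∪
        twoPoint e f n '' {j} := by
  rintro u ⟨hu, hi, h⟩
  obtain ⟨s, hs, rfl⟩ | ⟨n', i, -, rfl⟩ := H.eq_of_idempotent hu hi
  · exact Or.inl ⟨s, ⟨hs, (H.const_mul_twoPoint_eq_iff n j hs).1 h⟩, rfl⟩
  · by_cases hn : n' = n
    · subst hn
      by_cases hij : i = j
      · exact Or.inr ⟨i, hij, rfl⟩
      · rw [H.twoPoint_mul_of_ne hij] at h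
        exact absurd (twoPoint_injective H.ne _ h).symm hj
    · rw [H.twoPoint_mul_of_ne' hn] at h
      exact absurd h.symm (twoPoint_ne_const H.ne _ _ _)

theorem idempotentsAbove_const {m : ℕ → ℕ} {h : S} (hh : h * h = h) (hf : h ≠ f) :
    idempotentsAbove (H.family m) (fun _ => h) ⊆ Set.range (fun s : S => fun _ : ℕ × ℕ => s) := by
  rintro u ⟨hu, hi, hu'⟩
  obtain ⟨s, hs, rfl⟩ | ⟨n, i, -, rfl⟩ := H.eq_of_idempotent hu hi
  · exact ⟨s, rfl⟩
  · have := congrFun hu' (n + 1, 0)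
    simp [twoPoint] at this
    rw [mul_comm, H.least h hh] at this
    exact absurd this.symm hf

theorem infinite_idempotentsAbove (m : ℕ → ℕ) :
    (idempotentsAbove (H.family m) (fun _ => f)).Infinite := by
  refine Set.infinite_of_injective_forall_mem (f := fun n => twoPoint e f n 0) ?_ fun n =>
    ⟨H.twoPoint_mem (Nat.zero_le _), H.twoPoint_mul_self n 0, ?_⟩
  · intro n n' h
    by_contra hn
    have := congrFun h (n, 0)
    simp [twoPoint, hn] at this
    exact H.ne this
  · funext x
    simp only [twoPoint, Pi.mul_apply]
    split_ifs
    · exact H.mul_eq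
    · exact H.idem_right

theorem ncard_const_union [Finite S] (n : ℕ) (J : Set ℕ) (hJ : J.Finite) :
    ((fun h : S => fun _ : ℕ × ℕ => h) '' {h | h * h = h ∧ h * e = e} ∪
      twoPoint e f n '' J).ncard = {h : S | h * h = h ∧ h * e = e}.ncard + J.ncard := by
  rw [Set.ncard_union_eq _ (Set.toFinite _) (hJ.image _), Set.ncard_image_of_injective,
    Set.ncard_image_of_injective _ (twoPoint_injective H.ne n)]
  · exact fun a b h => congrFun h (0, 0)
  · rw [Set.disjoint_left]
    rintro _ ⟨s, -, rfl⟩ ⟨j, -, h⟩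
    exact twoPoint_ne_const H.ne _ _ _ h

theorem continuum_le [Finite S] : Cardinal.continuum ≤ subdirectPowerType.{u, v} S := by
  classical
  have : Nonempty S := ⟨e⟩
  set K := Nat.card S + 1 with hK
  -- For `n ∈ A` the count is `r + n + K + 1`. Every other kind of idempotent has at most `|S|` or
  -- `r + 1` idempotents above it, or infinitely many, where `ncard` is `0`.
  let m : Set ℕ → ℕ → ℕ := fun A n => if n ∈ A then n + K else 0
  refine continuum_le_subdirectPowerType_of_family (fun A => H.family (m A))
    (fun A => H.countable_family _) (fun A s => H.const_mem _ s) fun A B φ n hn => ?_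
  set r := {h : S | h * h = h ∧ h * e = e}.ncard with hr
  have hIic : ∀ k : ℕ, (Set.Iic k).ncard = k + 1 := fun k => by
    rw [← Finset.coe_Iic, Set.ncard_coe_finset, Nat.card_Iic]
  have hzero : ∀ A n, (idempotentsAbove (H.family (m A)) (twoPoint e f n 0)).ncard =
      r + (m A n + 1) := fun A n => by
    rw [H.idempotentsAbove_twoPoint_zero, H.ncard_const_union n _ (Set.finite_Iic _), hIic]
  let t : H.family (m A) := ⟨twoPoint e f n 0, H.twoPoint_mem (Nat.zero_le _)⟩
  have hcard := ncard_idempotentsAbove φ t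
  rw [hzero A n] at hcard
  have hmA : m A n = n + K := if_pos hn
  rw [hmA] at hcard
  have hidem : (φ t : ℕ × ℕ → S) * φ t = φ t := by
    rw [← MulMemClass.coe_mul, ← map_mul]
    exact congrArg (fun z => (φ z : ℕ × ℕ → S)) (Subtype.ext (H.twoPoint_mul_self n 0))
  obtain ⟨h, hh, heq⟩ | ⟨n', j, hj, heq⟩ := H.eq_of_idempotent (φ t).2 hidem
  · rw [heq] at hcard
    by_cases hf : h = f
    · rw [hf, (H.infinite_idempotentsAbove _).ncard] at hcard
      omega
    · have h1 := Set.ncard_le_ncard (H.idempotentsAbove_const (m := m B) hh hf) (Set.toFinite _)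
      have h2 : (Set.range (fun s : S => fun _ : ℕ × ℕ => s)).ncard ≤ Nat.card S := by
        rw [← Set.image_univ, ← Set.ncard_univ]
        exact Set.ncard_image_le
      omega
  · rw [heq] at hcard
    by_cases hj0 : j = 0
    · subst hj0
      rw [hzero] at hcard
      by_cases hn' : n' ∈ B
      · have : m B n' = n' + K := if_pos hn'
        have : n = n' := by omega
        exact this ▸ hn'
      · have : m B n' = 0 := if_neg hn'
        omega
    · have h1 := Set.ncard_le_ncard
        (H.idempotentsAbove_twoPoint_of_ne_zero (m := m B) (n := n') hj0)
        ((Set.toFinite _).union ((Set.finite_singleton _).image _))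
      rw [H.ncard_const_union n' _ (Set.finite_singleton j), Set.ncard_singleton] at h1
      omega

end IsIdempotentAtom

end TwoIdempotents

/-! ### Distinct elements with equal translations -/

section EqualTranslations

variable {S : Type u}

/-- The function equal to `c` at `(n, 0)`, to `a` at `(n, j)` if `j ≠ 0`, and to `b` elsewhere. -/
def markedPoint (a b c : S) (n j : ℕ) (x : ℕ × ℕ) : S :=
  if x = (n, 0) then c else if x = (n, j) then a else b

theorem markedPoint_injective {a b : S} (c : S) (h : a ≠ b) (n : ℕ) :
    Function.Injective (markedPoint a b c n) := by
  intro i j hij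
  by_contra hne
  have h1 := congrFun hij (n, i)
  have h2 := congrFun hij (n, j)
  simp only [markedPoint, Prod.mk.injEq, true_and, if_true, Ne.symm hne, hne, if_false] at h1 h2
  split_ifs at h1 h2 <;> first | omega | exact h h1 | exact h h2.symm

/-- Functions with the same value at all but finitely many points. -/
def AlmostConst {X : Type*} (t : X → S) : Prop := ∃ g, {x | t x ≠ g}.Finite

theorem almostConst_const {X : Type*} (s : S) : AlmostConst fun _ : X => s := ⟨s, by simp⟩

theorem almostConst_markedPoint (a b c : S) (n j : ℕ) : AlmostConst (markedPoint a b c n j) := by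
  refine ⟨b, (Set.toFinite {(n, 0), (n, j)}).subset fun x hx => ?_⟩
  by_contra h
  simp only [Set.mem_insert_iff, Set.mem_singleton_iff, not_or] at h
  exact hx (by simp [markedPoint, h])

theorem countable_almostConst {X : Type*} [Countable X] [Finite S] :
    {t : X → S | AlmostConst t}.Countable := by
  rw [show {t : X → S | AlmostConst t} = ⋃ g, {t : X → S | {x | t x ≠ g}.Finite} by
    ext; simp [AlmostConst]]
  refine Set.countable_iUnion fun g => ?_
  -- With `g` as zero, these functions are the finitely supported ones.
  let : Zero S := ⟨g⟩
  refine (Set.countable_range fun t : X →₀ S => (t : X → S)).mono fun t ht => ?_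
  exact ⟨Finsupp.ofSupportFinite t ht, Finsupp.ofSupportFinite_coe⟩

theorem AlmostConst.mul {X : Type*} [Mul S] {t t' : X → S} (h : AlmostConst t)
    (h' : AlmostConst t') : AlmostConst (t * t') := by
  obtain ⟨g, hg⟩ := h
  obtain ⟨g', hg'⟩ := h'
  refine ⟨g * g', (hg.union hg').subset fun x hx => ?_⟩
  by_contra hn
  simp only [Set.mem_union, Set.mem_ofPred_eq, not_or, not_not] at hn
  exact hx (by rw [Pi.mul_apply, hn.1, hn.2])

/-- The elements of `T` acting on `T` by multiplication in the same way as `t`. -/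
def translationClass {M : Type*} [Semigroup M] (T : Subsemigroup M) (t : M) : Set M :=
  {u | u ∈ T ∧ ∀ v ∈ T, u * v = t * v}

theorem ncard_translationClass {M N : Type*} [Semigroup M] [Semigroup N] {T : Subsemigroup M}
    {T' : Subsemigroup N} (φ : T ≃* T') (t : T) :
    (translationClass T' (φ t : N)).ncard = (translationClass T (t : M)).ncard := by
  symm
  refine Set.ncard_congr (fun u hu => (φ ⟨u, hu.1⟩ : N)) ?_ ?_ ?_
  · rintro u ⟨hu, h⟩
    refine ⟨(φ _).2, fun v hv => ?_⟩
    obtain ⟨v', hv'⟩ := φ.surjective ⟨v, hv⟩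
    have : φ ⟨u, hu⟩ * φ v' = φ t * φ v' := by
      rw [← map_mul, ← map_mul]
      exact congrArg φ (Subtype.ext (h v' v'.2))
    rw [hv'] at this
    exact Subtype.ext_iff.1 this
  · rintro u u' hu hu' h
    exact Subtype.ext_iff.1 (φ.injective (Subtype.ext h))
  · rintro u ⟨hu, h⟩
    refine ⟨φ.symm ⟨u, hu⟩, ⟨(φ.symm _).2, fun v hv => ?_⟩, by simp⟩
    have : φ.symm ⟨u, hu⟩ * ⟨v, hv⟩ = t * ⟨v, hv⟩ := by
      apply φ.injective
      rw [map_mul, map_mul, MulEquiv.apply_symm_apply]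
      exact Subtype.ext (h _ (φ _).2)
    exact Subtype.ext_iff.1 this

/-- Functions whose values act by multiplication in the same way at every point. -/
def SameTranslations {X : Type*} [Mul S] (t t' : X → S) : Prop := ∀ x s, t x * s = t' x * s

theorem SameTranslations.symm {X : Type*} [Mul S] {t t' : X → S} (h : SameTranslations t t') :
    SameTranslations t' t := fun x s => (h x s).symm

theorem SameTranslations.trans {X : Type*} [Mul S] {t t' t'' : X → S} (h : SameTranslations t t')
    (h' : SameTranslations t' t'') : SameTranslations t t'' := fun x s => (h x s).trans (h' x s)

theorem mem_translationClass_iff {X : Type*} [Semigroup S] {T : Subsemigroup (X → S)}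
    (hT : ∀ s, (fun _ => s) ∈ T) {t u : X → S} :
    u ∈ translationClass T t ↔ u ∈ T ∧ SameTranslations u t :=
  and_congr_right fun _ => ⟨fun h x s => congrFun (h _ (hT s)) x,
    fun h v _ => funext fun x => h x (v x)⟩

theorem ncard_range_const_le [Finite S] :
    (Set.range fun s : S => fun _ : ℕ × ℕ => s).ncard ≤ Nat.card S := by
  rw [← Set.image_univ, ← Set.ncard_univ]
  exact Set.ncard_image_le

variable [CommSemigroup S]

/-- The almost constant functions that are constant or have all values in the ideal `I`. -/
def almostConstIdeal (I : Set S) (hI : ∀ i ∈ I, ∀ s, i * s ∈ I) : Subsemigroup (ℕ × ℕ → S) where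
  carrier := {t | AlmostConst t ∧ ((∃ s, t = fun _ => s) ∨ ∀ x, t x ∈ I)}
  mul_mem' := by
    rintro t t' ⟨ht, h⟩ ⟨ht', h'⟩
    refine ⟨ht.mul ht', ?_⟩
    obtain ⟨s, rfl⟩ | h := h
    · obtain ⟨s', rfl⟩ | h' := h'
      · exact Or.inl ⟨s * s', rfl⟩
      · exact Or.inr fun x => by rw [Pi.mul_apply, mul_comm]; exact hI _ (h' x) _
    · exact Or.inr fun x => hI _ (h x) _

/-- The elements `a ≠ b` act on `S` in the same way, `c` acts differently, and `a` and `c`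
multiply `S` into the ideal `I`; the last two fields control how often a pattern of actions is
realised by almost constant functions that are constant or `I`-valued. -/
structure IsMarkedTriple (I : Set S) (a b c : S) : Prop where
  ideal : ∀ i ∈ I, ∀ s, i * s ∈ I
  left_mul_mem : ∀ s, a * s ∈ I
  right_mul_mem : ∀ s, c * s ∈ I
  ne : a ≠ b
  mul_eq : ∀ s, a * s = b * s
  mul_ne : ∃ s, c * s ≠ b * s
  eq_markedPoint : ∀ n (u : ℕ × ℕ → S), (∀ x, u x ∈ I) →
    SameTranslations u (markedPoint a b c n 0) → u = markedPoint a b c n 0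
  ncard_le : ∀ t ∈ almostConstIdeal I ideal, {u | u ∈ almostConstIdeal I ideal ∧
    SameTranslations u t}.ncard ≤ Nat.card S + 1

namespace IsMarkedTriple

variable {I : Set S} {a b c : S} (H : IsMarkedTriple I a b c)
include H

theorem markedPoint_mul_mem (n j : ℕ) (x : ℕ × ℕ) (s : S) : markedPoint a b c n j x * s ∈ I := by
  rw [markedPoint]
  split_ifs
  · exact H.right_mul_mem s
  · exact H.left_mul_mem s
  · exact H.mul_eq s ▸ H.left_mul_mem s

theorem markedPoint_mul_eq {n j : ℕ} {x : ℕ × ℕ} (hx : x ≠ (n, 0)) (s : S) :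
    markedPoint a b c n j x * s = b * s := by
  rw [markedPoint, if_neg hx]
  split_ifs
  · exact H.mul_eq s
  · rfl

theorem sameTranslations (n j j' : ℕ) :
    SameTranslations (markedPoint a b c n j) (markedPoint a b c n j') := by
  intro x s
  by_cases hx : x = (n, 0)
  · simp [markedPoint, hx]
  · rw [H.markedPoint_mul_eq hx, H.markedPoint_mul_eq hx]

theorem eq_of_sameTranslations {n j n' j' : ℕ}
    (h : SameTranslations (markedPoint a b c n j) (markedPoint a b c n' j')) : n = n' := by
  by_contra hn
  obtain ⟨s, hs⟩ := H.mul_ne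
  have := h (n, 0) s
  rw [H.markedPoint_mul_eq (n := n') (by simpa using hn)] at this
  exact hs (by simpa [markedPoint] using this)

theorem not_sameTranslations_const (n j : ℕ) (r : S) :
    ¬ SameTranslations (fun _ => r) (markedPoint a b c n j) := by
  intro h
  obtain ⟨s, hs⟩ := H.mul_ne
  have h1 := h (n, 0) s
  have h2 := h (n + 1, 0) s
  rw [H.markedPoint_mul_eq (by simp)] at h2
  rw [h2] at h1
  exact hs (by simpa [markedPoint] using h1.symm)

/-- The almost constant functions that are constant or `I`-valued, together with the functions
`markedPoint a b c n j` with `n ∈ A` and `j ≤ n + K`. -/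
def family (K : ℕ) (A : Set ℕ) : Subsemigroup (ℕ × ℕ → S) where
  carrier := {t | t ∈ almostConstIdeal I H.ideal ∨
    ∃ n ∈ A, ∃ j ≤ n + K, t = markedPoint a b c n j}
  mul_mem' := by
    have aux : ∀ n j t, AlmostConst t → markedPoint a b c n j * t ∈ almostConstIdeal I H.ideal :=
      fun n j t ht => ⟨(almostConst_markedPoint a b c n j).mul ht,
        Or.inr fun x => H.markedPoint_mul_mem n j x (t x)⟩
    rintro t t' (h | ⟨n, -, j, -, rfl⟩) (h' | ⟨n', -, j', -, rfl⟩)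
    · exact Or.inl (Subsemigroup.mul_mem _ h h')
    · exact Or.inl (by rw [mul_comm]; exact aux _ _ _ h.1)
    · exact Or.inl (aux _ _ _ h'.1)
    · exact Or.inl (aux _ _ _ (almostConst_markedPoint _ _ _ _ _))

theorem const_mem (K : ℕ) (A : Set ℕ) (s : S) : (fun _ => s) ∈ H.family K A :=
  Or.inl ⟨almostConst_const s, Or.inl ⟨s, rfl⟩⟩

theorem countable_family [Finite S] (K : ℕ) (A : Set ℕ) :
    (H.family K A : Set (ℕ × ℕ → S)).Countable := by
  refine countable_almostConst.mono ?_
  rintro t (h | ⟨n, -, j, -, rfl⟩)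
  · exact h.1
  · exact almostConst_markedPoint _ _ _ _ _

/-- The position of `c` is visible to translations, while that of `a` is not; the class therefore
consists of the markers with this `n`. -/
theorem ncard_translationClass_of_sameTranslations {K : ℕ} {A : Set ℕ} {n j : ℕ} (hn : n ∈ A)
    {t : ℕ × ℕ → S} (ht : SameTranslations t (markedPoint a b c n j)) :
    (translationClass (H.family K A) t).ncard = n + K + 1 := by
  have : translationClass (H.family K A) t = markedPoint a b c n '' Set.Iic (n + K) := by
    ext u
    rw [mem_translationClass_iff (H.const_mem K A)]
    constructor
    · rintro ⟨hu, h⟩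
      have h := (h.trans ht).trans (H.sameTranslations n j 0)
      obtain ⟨-, ⟨s, rfl⟩ | hu⟩ | ⟨n', -, j', hj', rfl⟩ := hu
      · exact absurd h (H.not_sameTranslations_const _ _ _)
      · exact ⟨0, Nat.zero_le _, (H.eq_markedPoint n u hu h).symm⟩
      · obtain rfl := H.eq_of_sameTranslations h
        exact ⟨j', hj', rfl⟩
    · rintro ⟨j', hj', rfl⟩
      exact ⟨Or.inr ⟨n, hn, j', hj', rfl⟩, (H.sameTranslations n j' j).trans ht.symm⟩
  rw [this, Set.ncard_image_of_injective _ (markedPoint_injective c H.ne n), ← Finset.coe_Iic,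
    Set.ncard_coe_finset, Nat.card_Iic]

theorem continuum_le [Finite S] : Cardinal.continuum ≤ subdirectPowerType.{u, v} S := by
  have : Nonempty S := ⟨a⟩
  let K := Nat.card S + 1
  refine continuum_le_subdirectPowerType_of_family (H.family K) (H.countable_family K)
    (H.const_mem K) fun A B φ n hn => ?_
  let t : H.family K A := ⟨markedPoint a b c n 0, Or.inr ⟨n, hn, 0, Nat.zero_le _, rfl⟩⟩
  have hcard := ncard_translationClass φ t
  rw [H.ncard_translationClass_of_sameTranslations hn (H.sameTranslations n 0 0)] at hcard
  by_cases h : ∃ n' ∈ B, SameTranslations (φ t : ℕ × ℕ → S) (markedPoint a b c n' 0)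
  · obtain ⟨n', hn', h⟩ := h
    rw [H.ncard_translationClass_of_sameTranslations hn' h] at hcard
    have : n = n' := by omega
    exact this ▸ hn'
  · push Not at h
    have hD : ∀ u ∈ H.family K B, SameTranslations u (φ t) →
        u ∈ almostConstIdeal I H.ideal := by
      rintro u (hu | ⟨n', hn', j, -, rfl⟩) hut
      · exact hu
      · exact absurd (hut.symm.trans (H.sameTranslations n' j 0)) (h n' hn')
    have heq : translationClass (H.family K B) (φ t) = {u | u ∈ almostConstIdeal I H.ideal ∧
        SameTranslations u (φ t)} := by
      ext u
      rw [mem_translationClass_iff (H.const_mem K B)]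
      exact ⟨fun hu => ⟨hD u hu.1 hu.2, hu.2⟩, fun hu => ⟨Or.inl hu.1, hu.2⟩⟩
    have := H.ncard_le (φ t) (hD _ (φ t).2 fun _ _ => rfl)
    rw [← heq, hcard] at this
    omega

end IsMarkedTriple

/-- Multiplying by `e` fixes every `I`-valued function, so translations determine it. A class thus
has at most one `I`-valued member besides constants. -/
theorem isMarkedTriple_of_fixed [Finite S] {e a c : S} (he : e * e = e) (ha : e * a ≠ a)
    (haS : ∀ s, e * (a * s) = a * s) (hc : e * c = c) (hca : c ≠ e * a) :
    IsMarkedTriple {s | e * s = s} a (e * a) c := by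
  have hI : ∀ i ∈ {s | e * s = s}, ∀ s, i * s ∈ {s | e * s = s} := fun i hi s => by
    have hi : e * i = i := hi
    show e * (i * s) = i * s
    rw [← mul_assoc, hi]
  have hsame : ∀ u u' : ℕ × ℕ → S, (∀ x, e * u x = u x) → (∀ x, e * u' x = u' x) →
      SameTranslations u u' → u = u' := fun u u' hu hu' h => funext fun x => by
    rw [← hu, ← hu', mul_comm, h x e, mul_comm]
  refine ⟨hI, haS, fun s => hI c hc s, ha.symm, fun s => ?_, ⟨e, ?_⟩, fun n u hu h => ?_,
    fun t ht => ?_⟩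
  · rw [mul_assoc, haS]
  · rw [mul_comm c, hc, mul_right_comm, he]
    exact hca
  · refine hsame _ _ hu (fun x => ?_) h
    rw [markedPoint]
    split_ifs
    · exact hc
    · rw [← mul_assoc, he]
  · set C := {u | (∀ x, e * u x = u x) ∧ SameTranslations u t}
    have hC : C.Subsingleton := fun u hu u' hu' => hsame _ _ hu.1 hu'.1 (hu.2.trans hu'.2.symm)
    have := hC.finite.to_subtype
    refine (Set.ncard_le_ncard (t := (Set.range fun s : S => fun _ : ℕ × ℕ => s) ∪ C) ?_
      ((Set.toFinite _).union hC.finite)).trans ((Set.ncard_union_le _ _).trans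
      (add_le_add ncard_range_const_le (Set.ncard_le_one_iff_subsingleton.2 hC)))
    rintro u ⟨⟨-, ⟨s, rfl⟩ | hu⟩, hut⟩
    · exact Or.inl ⟨s, rfl⟩
    · exact Or.inr ⟨hu, hut⟩

/-- All `I`-valued functions act as zero. The class of the zero action is infinite, so its `ncard`
is `0`; any other class contains only constants. No `I`-valued function acts like a marker, since `x
* y ≠ e`. -/
theorem isMarkedTriple_of_annihilator [Finite S] {e x y : S} (he : ∀ s, e * s = e)
    (hx : ∀ s r, x * s * r = e) (hxy : x * y ≠ e) :
    IsMarkedTriple {i | ∀ s, i * s = e} (x * y) e x := by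
  have hI : ∀ i ∈ {i | ∀ s, i * s = e}, ∀ s, i * s ∈ {i | ∀ s, i * s = e} :=
    fun i hi s r => by
      have hi : ∀ s, i * s = e := hi
      rw [hi, he]
  refine ⟨hI, fun s => hI _ (hx y) s, fun s => hx s, hxy, fun s => ?_, ⟨y, ?_⟩, fun n u hu h => ?_,
    fun t ht => ?_⟩
  · rw [hx, he]
  · rwa [he]
  · have h1 := h (n, 0) y
    rw [hu (n, 0) y] at h1
    exact absurd (by simpa [markedPoint] using h1.symm) hxy
  · by_cases h : ∃ u, SameTranslations u t ∧ ∀ x s, u x * s = e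
    · obtain ⟨u, hut, hu⟩ := h
      rw [Set.Infinite.ncard]
      · exact Nat.zero_le _
      refine Set.infinite_of_injective_forall_mem (f := markedPoint (x * y) e e 0)
        (markedPoint_injective e hxy 0) fun j => ?_
      have hj : ∀ z s, markedPoint (x * y) e e 0 j z * s = e := by
        intro z s
        rw [markedPoint]
        split_ifs
        · exact he s
        · exact hx y s
        · exact he s
      exact ⟨⟨almostConst_markedPoint _ _ _ _ _, Or.inr hj⟩,
        fun z s => (hj z s).trans ((hu z s).symm.trans (hut z s))⟩
    · push Not at h
      refine (Set.ncard_le_ncard (t := Set.range fun s : S => fun _ : ℕ × ℕ => s) ?_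
        (Set.toFinite _)).trans (ncard_range_const_le.trans (Nat.le_succ _))
      rintro u ⟨⟨-, ⟨s, rfl⟩ | hu⟩, hut⟩
      · exact ⟨s, rfl⟩
      · obtain ⟨x, s, hxs⟩ := h u hut
        exact absurd (hu x s) hxs

end EqualTranslations

/-! ### Finding the configurations in `S` -/

section FiniteCommutative

variable {S : Type u} [CommSemigroup S] [Finite S]

theorem exists_idempotent_mem {C : Set S} (hne : C.Nonempty)
    (hC : ∀ x ∈ C, ∀ y ∈ C, x * y ∈ C) : ∃ e ∈ C, e * e = e := by
  let : TopologicalSpace S := ⊥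
  have : DiscreteTopology S := ⟨rfl⟩
  exact exists_idempotent_in_compact_subsemigroup (fun _ => continuous_of_discreteTopology) C hne
    C.toFinite.isCompact hC

theorem exists_minimal_idempotent {E : Set S} (hne : E.Nonempty) (hE : ∀ h ∈ E, h * h = h) :
    ∃ f ∈ E, ∀ h ∈ E, f * h = h → h = f := by
  -- The set of `u` fixing `h` grows as `h` descends, so a largest one marks a minimal idempotent.
  obtain ⟨f, hf, hmax⟩ := Set.exists_max_image E (fun h => {u | u * h = h}.ncard) E.toFinite hne
  refine ⟨f, hf, fun h hh hfh => ?_⟩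
  have hsub : {u | u * f = f} ⊆ {u | u * h = h} := fun u hu => by
    have hu : u * f = f := hu
    show u * h = h
    rw [← hfh, ← mul_assoc, hu]
  have heq := Set.eq_of_subset_of_ncard_le hsub (hmax h hh) (Set.toFinite _)
  have : h ∈ {u | u * f = f} := heq ▸ hE h hh
  have : h * f = f := this
  rw [← hfh, mul_comm, this]

theorem exists_isIdempotentAtom {e₁ e₂ : S} (h₁ : e₁ * e₁ = e₁) (h₂ : e₂ * e₂ = e₂)
    (hne : e₁ ≠ e₂) : ∃ e f : S, IsIdempotentAtom e f := by
  obtain ⟨f, hf, hmin⟩ := exists_minimal_idempotent (E := {h : S | h * h = h}) ⟨e₁, h₁⟩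
    fun _ h => h
  have hf : f * f = f := hf
  have hleast : ∀ h : S, h * h = h → h * f = f := fun h hh => by
    rw [mul_comm]
    refine hmin _ ?_ (by rw [← mul_assoc, hf])
    show f * h * (f * h) = f * h
    rw [mul_mul_mul_comm, hf, hh]
  have : ∃ e' : S, e' * e' = e' ∧ e' ≠ f := by
    by_cases h : e₁ = f
    · exact ⟨e₂, h₂, fun h' => hne (h.trans h'.symm)⟩
    · exact ⟨e₁, h₁, h⟩
  obtain ⟨e, ⟨he, hef⟩, hmin'⟩ := exists_minimal_idempotent
    (E := {h : S | h * h = h ∧ h ≠ f}) this fun _ h => h.1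
  exact ⟨e, f, he, hf, hleast e he, hef, hleast, fun h hh heh =>
    or_iff_not_imp_right.2 fun hhf => hmin' h ⟨hh, hhf⟩ heh⟩

/-- Choose `x` outside `I` with `xS` smallest. If `x * s ∉ I`, then `xsS = xS` contains `x * s`, so
some idempotent fixes `x * s`; it lies in `I`, a contradiction. -/
theorem exists_notMem_ideal_mul_mem {I : Set S} (hI : ∀ i ∈ I, ∀ s, i * s ∈ I)
    (hidem : ∀ e : S, e * e = e → e ∈ I) {x₀ : S} (hx₀ : x₀ ∉ I) :
    ∃ x, x ∉ I ∧ ∀ s, x * s ∈ I := by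
  obtain ⟨x, hx, hmin⟩ := Set.exists_min_image Iᶜ (fun x => (Set.range (x * ·)).ncard)
    (Set.toFinite _) ⟨x₀, hx₀⟩
  refine ⟨x, hx, fun s => ?_⟩
  by_contra hs
  have hsub : Set.range (x * s * ·) ⊆ Set.range (x * ·) := by
    rintro _ ⟨t, rfl⟩
    exact ⟨s * t, (mul_assoc _ _ _).symm⟩
  have heq := Set.eq_of_subset_of_ncard_le hsub (hmin _ hs) (Set.toFinite _)
  have hmem : x * s ∈ Set.range (x * s * ·) := heq ▸ ⟨s, rfl⟩
  obtain ⟨t, ht⟩ := hmem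
  obtain ⟨e, he, hee⟩ := exists_idempotent_mem (C := {u | x * s * u = x * s}) ⟨t, ht⟩
    fun u hu v hv => by
      have hu : x * s * u = x * s := hu
      show x * s * (u * v) = x * s
      rw [← mul_assoc, hu]
      exact hv
  have he : x * s * e = x * s := he
  exact hs (he ▸ mul_comm e (x * s) ▸ hI e (hidem e hee) _)

theorem continuum_le_of_not_group_of_not_null [Nonempty S] (hg : ¬ IsAbelianGroupSemigroup S)
    (hn : ¬ IsNullSemigroup S) : Cardinal.continuum ≤ subdirectPowerType.{u, v} S := by
  obtain ⟨e, -, he⟩ := exists_idempotent_mem (C := (Set.univ : Set S)) Set.univ_nonempty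
    fun _ _ _ _ => trivial
  by_cases huniq : ∃ e' : S, e' * e' = e' ∧ e' ≠ e
  · obtain ⟨e', he', hne⟩ := huniq
    obtain ⟨_, _, H⟩ := exists_isIdempotentAtom he' he hne
    exact H.continuum_le
  push Not at huniq
  by_cases hzero : ∀ s, e * s = e
  · have : ∃ x₀, x₀ ∉ {i | ∀ s, i * s = e} := by
      by_contra! h
      exact hn ⟨e, h⟩
    obtain ⟨x₀, hx₀⟩ := this
    obtain ⟨x, hx, hxs⟩ := exists_notMem_ideal_mul_mem (I := {i | ∀ s, i * s = e})
      (fun i hi s r => by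
        have hi : ∀ s, i * s = e := hi
        rw [hi, hzero]) (fun e' he' => huniq e' he' ▸ hzero) hx₀
    have : ∃ y, x * y ≠ e := by
      by_contra! h
      exact hx h
    obtain ⟨y, hy⟩ := this
    exact (isMarkedTriple_of_annihilator hzero hxs hy).continuum_le
  · push Not at hzero
    obtain ⟨g, hg'⟩ := hzero
    have : ∃ x₀, x₀ ∉ {s | e * s = s} := by
      by_contra! h
      refine hg ⟨mul_comm, e, h, fun s => ?_⟩
      -- The idempotent in `sS` can only be `e`, which provides an inverse of `s`.
      obtain ⟨_, ⟨t, rfl⟩, h'⟩ := exists_idempotent_mem (C := Set.range (s * ·)) ⟨_, s, rfl⟩ (by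
        rintro _ ⟨t, rfl⟩ _ ⟨t', rfl⟩
        exact ⟨t * (s * t'), (mul_assoc _ _ _).symm⟩)
      exact ⟨t, (mul_comm t s).trans (huniq _ h')⟩
    obtain ⟨x₀, hx₀⟩ := this
    obtain ⟨a, ha, haS⟩ := exists_notMem_ideal_mul_mem (I := {s | e * s = s})
      (fun i hi s => by
        have hi : e * i = i := hi
        show e * (i * s) = i * s
        rw [← mul_assoc, hi]) (fun e' he' => huniq e' he' ▸ he) hx₀
    -- As `e` is not a zero, `eS` contains `e * g ≠ e`, so one of `e` and `e * g` differs from `e *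
    -- a`.
    have : ∃ c, e * c = c ∧ c ≠ e * a := by
      by_cases h : e = e * a
      · exact ⟨e * g, by rw [← mul_assoc, he], h ▸ hg'⟩
      · exact ⟨e, he, h⟩
    obtain ⟨c, hc, hca⟩ := this
    exact (isMarkedTriple_of_fixed he ha haS hc hca).continuum_le

end FiniteCommutative

theorem mainTheorem1 (S : Type u) [CommSemigroup S] [Finite S] [Nonempty S] :
    (subdirectPowerType.{u, v} S ≤ Cardinal.aleph0 ↔
      (IsAbelianGroupSemigroup S ∨ IsNullSemigroup S)) ∧
    (¬ (IsAbelianGroupSemigroup S ∨ IsNullSemigroup S) →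
      subdirectPowerType.{u, v} S = Cardinal.continuum) := by
  have key : ¬ (IsAbelianGroupSemigroup S ∨ IsNullSemigroup S) →
      subdirectPowerType.{u, v} S = Cardinal.continuum := fun h => by
    rw [not_or] at h
    exact subdirectPowerType_le_continuum.antisymm (continuum_le_of_not_group_of_not_null h.1 h.2)
  refine ⟨⟨fun hle => ?_, ?_⟩, key⟩
  · by_contra h
    rw [key h] at hle
    exact absurd hle Cardinal.aleph0_lt_continuum.not_ge
  · rintro (h | h)
    · exact h.subdirectPowerType_le
    · exact h.subdirectPowerType_le
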